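/- All systems are finite-dimensional with fixed bases; a state is a density matrix (positive semidefinite, trace one), $T$ denotes transposition in the fixed basis, and a channel is a completely positive trace-preserving linear map. For a channel $\mathcal E$ from a system with basis $\{|i\rangle\}$, let $C_{\mathcal E}=\sum_{i,j}\mathcal E(|i\rangle\langle j|)\otimes|i\rangle\langle j|$ be its Choi operator; $\mathcal E$ is called full-rank if $C_{\mathcal E}$ has full rank. For states $\rho,\gamma$ of the input system and $\tau$ of the output system put $$Q_F^{\mathcal E}(\rho)=\sqrt{C_{\mathcal E}}\,(\mathbb 1\otimes\rho^T)\sqrt{C_{\mathcal E}},\qquad Q_R^{\mathcal E,\gamma}(\tau)=\sqrt{C_{\mathcal E}}\,\bigl(\mathcal E(\gamma)^{-1/2}\tau\,\mathcal E(\gamma)^{-1/2}\otimes\gamma^T\bigr)\sqrt{C_{\mathcal E}},$$ $$\Sigma[P,Q]=\log\bigl(\sqrt P\,Q^{-1}\sqrt P\bigr),\qquad \langle\Sigma\rangle(\mathcal E;\rho,\gamma,\tau)=\mathrm{Tr}\bigl\{Q_F^{\mathcal E}(\rho)\,\Sigma[Q_F^{\mathcal E}(\rho),Q_R^{\mathcal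 E,\gamma}(\tau)]\bigr\},$$ where inverses and logarithms are taken on supports. Let $\mathcal E_1$ and $\mathcal E_2$ be full-rank channels such that $\mathcal E_2\circ\mathcal E_1$ is defined, let $\rho,\gamma$ be states of the input system of $\mathcal E_1$, and let $\tau_1,\tau_2$ be states of the output systems of $\mathcal E_1,\mathcal E_2$. Assume that the supports of $Q_F^{\mathcal E_1}(\rho)$ and $Q_F^{\mathcal E_2}(\mathcal E_1(\rho))$ are contained in those of $Q_R^{\mathcal E_1,\gamma}(\tau_1)$ and $Q_R^{\mathcal E_2,\mathcal E_1(\gamma)}(\tau_2)$ respectively (equivalently, $\tau_1,\tau_2$ are invertible and $\mathrm{supp}\,\rho\subseteq\mathrm{supp}\,\gamma$; the analogous inclusion for $\mathcal E_2\circ\mathcal E_1$ with reverse input $\tau_2$ then follows). Put $$\langle\Sigma_1\rangle=\langle\Sigma\rangle(\mathcal E_1;\rho,\gamma,\tau_1),\quad \langle\Sigma_2\rangle=\langle\Sigma\rangle(\mathcal E_2;\mathcal E_1(\rho),\mathcal E_1(\gamma),\tau_2),\quad \langle\Sigma_{12}\rangle=\langle\Sigma\rangle(\mathcal E_2\circ\mathcal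 E_1;\rho,\gamma,\tau_2).$$ Then $$\langle\Sigma_1\rangle+\langle\Sigma_2\rangle\ \ge\ \langle\Sigma_{12}\rangle,$$ and equality holds if and only if $\tau_1=\mathcal E_1(\rho)$ and $[\mathcal E_1(\rho),\mathcal E_1(\gamma)]=0$. -/

import Mathlib

open scoped Matrix ComplexOrder Kronecker

/-- A density matrix: positive semidefinite with unit trace. -/
def IsDensity {a : Type*} [Fintype a] (ρ : Matrix a a ℂ) : Prop :=
  ρ.PosSemidef ∧ ρ.trace = 1

/-- The map `E ⊗ id` on matrices over `a × Fin k`: `E` applied to every block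
`(M (·, i) (·, j))` of `M`. -/
def ampliation {a b : Type*} (k : ℕ) (E : Matrix a a ℂ →ₗ[ℂ] Matrix b b ℂ)
    (M : Matrix (a × Fin k) (a × Fin k) ℂ) : Matrix (b × Fin k) (b × Fin k) ℂ :=
  Matrix.of fun x y => E (Matrix.of fun s t => M (s, x.2) (t, y.2)) x.1 y.1

/-- A quantum channel: a completely positive, trace preserving linear map. -/
structure IsChannel {a b : Type*} [Fintype a] [Fintype b]
    (E : Matrix a a ℂ →ₗ[ℂ] Matrix b b ℂ) : Prop where
  completelyPositive : ∀ (k : ℕ) (M : Matrix (a × Fin k) (a × Fin k) ℂ),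
    M.PosSemidef → (ampliation k E M).PosSemidef
  tracePreserving : ∀ M : Matrix a a ℂ, (E M).trace = M.trace

/-- The Choi operator `∑ i j, E(|i⟩⟨j|) ⊗ |i⟩⟨j|`. -/
def choi {a b : Type*} [Fintype a] [DecidableEq a]
    (E : Matrix a a ℂ →ₗ[ℂ] Matrix b b ℂ) : Matrix (b × a) (b × a) ℂ :=
  ∑ i : a, ∑ j : a, E (Matrix.single i j 1) ⊗ₖ Matrix.single i j (1 : ℂ)

/-- A channel is full-rank if its Choi operator has full rank. -/
def FullRank {a b : Type*} [Fintype a] [DecidableEq a] [Fintype b]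
    (E : Matrix a a ℂ →ₗ[ℂ] Matrix b b ℂ) : Prop :=
  (choi E).rank = Fintype.card (b × a)

noncomputable section

/-- Every real function is continuous on the (finite) spectrum of a matrix, so that `cfc f M` below
is `f` applied to the eigenvalues of the Hermitian matrix `M`. -/
theorem continuousOn_spectrum_matrix {n : Type*} [Fintype n] [DecidableEq n]
    (f : ℝ → ℝ) (M : Matrix n n ℂ) : ContinuousOn f (spectrum ℝ M) :=
  (Matrix.finite_real_spectrum (A := M)).continuousOn f

/-- The square root of a positive semidefinite matrix. -/
def msqrt {n : Type*} [Fintype n] [DecidableEq n] (M : Matrix n n ℂ) : Matrix n n ℂ :=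
  cfc Real.sqrt M

/-- The inverse of a Hermitian matrix on its support (and zero on its kernel). -/
def minv {n : Type*} [Fintype n] [DecidableEq n] (M : Matrix n n ℂ) : Matrix n n ℂ :=
  cfc (fun x : ℝ => x⁻¹) M

/-- The power `M ^ (-1/2)` of a positive semidefinite matrix, taken on its support. -/
def minvSqrt {n : Type*} [Fintype n] [DecidableEq n] (M : Matrix n n ℂ) : Matrix n n ℂ :=
  cfc (fun x : ℝ => (Real.sqrt x)⁻¹) M

/-- The logarithm of a positive semidefinite matrix, taken on its support (`Real.log 0 = 0`). -/
def mlog {n : Type*} [Fintype n] [DecidableEq n] (M : Matrix n n ℂ) : Matrix n n ℂ :=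
  cfc Real.log M

/-- The forward operator `Q_F(ρ) = √C (1 ⊗ ρᵀ) √C`, with `C` the Choi operator of `E`. -/
def forwardOp {a b : Type*} [Fintype a] [DecidableEq a] [Fintype b] [DecidableEq b]
    (E : Matrix a a ℂ →ₗ[ℂ] Matrix b b ℂ) (ρ : Matrix a a ℂ) : Matrix (b × a) (b × a) ℂ :=
  msqrt (choi E) * ((1 : Matrix b b ℂ) ⊗ₖ ρᵀ) * msqrt (choi E)

/-- The reverse operator `Q_R^γ(τ) = √C (E(γ)^(-1/2) τ E(γ)^(-1/2) ⊗ γᵀ) √C`,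
with `C` the Choi operator of `E`. -/
def reverseOp {a b : Type*} [Fintype a] [DecidableEq a] [Fintype b] [DecidableEq b]
    (E : Matrix a a ℂ →ₗ[ℂ] Matrix b b ℂ) (γ : Matrix a a ℂ) (τ : Matrix b b ℂ) :
    Matrix (b × a) (b × a) ℂ :=
  msqrt (choi E) * ((minvSqrt (E γ) * τ * minvSqrt (E γ)) ⊗ₖ γᵀ) * msqrt (choi E)

/-- For Hermitian matrices: the support (that is, the range) of `P` is contained in that of `Q`,
so that `Q` is invertible on the support of `P`. -/
def SupportLE {n : Type*} [Fintype n] (P Q : Matrix n n ℂ) : Prop :=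
  LinearMap.range P.mulVecLin ≤ LinearMap.range Q.mulVecLin

/-- The entropy production operator `Σ[P, Q] = log (√P Q⁻¹ √P)`. -/
def entropyProductionOp {n : Type*} [Fintype n] [DecidableEq n] (P Q : Matrix n n ℂ) :
    Matrix n n ℂ :=
  mlog (msqrt P * minv Q * msqrt P)

/-- The average `Tr[Q_F Σ[Q_F, Q_R]]` of the entropy production of the process `E` with input `ρ`,
prior `γ` and reverse input `τ`. The trace is real (it is that of a product of two Hermitian
matrices), so nothing is lost in taking the real part. -/
def avgEntropyProduction {a b : Type*} [Fintype a] [DecidableEq a] [Fintype b] [DecidableEq b]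
    (E : Matrix a a ℂ →ₗ[ℂ] Matrix b b ℂ) (ρ γ : Matrix a a ℂ) (τ : Matrix b b ℂ) : ℝ :=
  (forwardOp E ρ * entropyProductionOp (forwardOp E ρ) (reverseOp E γ τ)).trace.re

end

/-!
The average entropy production of a process splits as
`⟨Σ⟩(E; ρ, γ, τ) = D(ρ‖γ) - Tr[E(ρ) log N]`, with `N = E(γ)^(-1/2) τ E(γ)^(-1/2)` and
`D(P‖Q) = Tr[P log (√P Q⁻¹ √P)]` the Belavkin–Staszewski relative entropy
(`avgEntropyProduction_eq`). Indeed, by `trace_mul_mlog_eq`, `Tr[Xᴴ X log (Xᴴ Q⁻¹ X)]` is the same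
for all `X` with `X Xᴴ = P` supported in `Q`. For the process operators, `X = √C (1 ⊗ √ρᵀ)` removes
the Choi operator `C` from the logarithm; what is left is the logarithm of a tensor product, which
splits (`mlog_kronecker`), and `C` reassembles the channel (`trace_choi_mul`). The formula needs
invertible Choi operators; that of the composite is invertible by `posDef_choi_comp`.

Write `R = E₁(ρ)`, `G = E₁(γ)`, `τ = τ₁`. In `⟨Σ₁⟩ + ⟨Σ₂⟩ - ⟨Σ₁₂⟩` the input term `D(ρ‖γ)` and the
final output term cancel, and `D(R‖G) - Tr[R log N]` with `N = G^(-1/2) τ G^(-1/2)` remains. With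
`M = G^(-1/2) R G^(-1/2)` and `S = √G` it equals
`Tr[S (M log M) S] - Tr[S M S log N] - Tr[S M S] + Tr[S S N]`, as the last two traces are both one.
In the eigenbases of `M` and `N` this is a combination with nonnegative weights of the terms
`m log m - m log n - m + n ≥ 0`, and it vanishes exactly when `M S = S N` (`klein_inequality`). The
latter says `τ = G^(-1/2) R G^(1/2)`; since `τ` is Hermitian, it means that `R` and `G` commute and
`τ = R` (`trace_mul_mlog_le`).
-/

open Matrix

/-! ### Functional calculus of Hermitian matrices -/

section FunctionalCalculus

variable {m n : Type*} [Fintype m] [DecidableEq m] [Fintype n] [DecidableEq n]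

/-- The functional calculus respects intertwiners: both sides are the same polynomial expression,
because `f` agrees with an interpolation polynomial on the two spectra. -/
theorem cfc_mul_of_intertwine (f : ℝ → ℝ) {H : Matrix m m ℂ} {L : Matrix n n ℂ} {K : Matrix m n ℂ}
    (hH : H.IsHermitian) (hL : L.IsHermitian) (h : H * K = K * L) :
    cfc f H * K = K * cfc f L := by
  classical
  set s : Finset ℝ := (finite_real_spectrum (A := H)).toFinset ∪
    (finite_real_spectrum (A := L)).toFinset with hs
  set p : Polynomial ℝ := Lagrange.interpolate s id f with hp
  have hev : ∀ x ∈ s, f x = p.eval x := fun x hx =>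
    (Lagrange.eval_interpolate_at_node (v := id) f (Set.injOn_id _) hx).symm
  have h1 : cfc f H = Polynomial.aeval H p := by
    rw [← cfc_polynomial p H hH]
    exact cfc_congr fun x hx => hev x (by simp [hs, hx])
  have h2 : cfc f L = Polynomial.aeval L p := by
    rw [← cfc_polynomial p L hL]
    exact cfc_congr fun x hx => hev x (by simp [hs, hx])
  rw [h1, h2]
  induction p using Polynomial.induction_on' with
  | add p q ihp ihq => rw [map_add, map_add, Matrix.add_mul, Matrix.mul_add, ihp, ihq]
  | monomial k r =>
    have : H ^ k * K = K * L ^ k := by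
      induction k with
      | zero => simp
      | succ k ih =>
        rw [pow_succ, pow_succ', Matrix.mul_assoc, h, ← Matrix.mul_assoc, ih, Matrix.mul_assoc,
          ← pow_succ, ← pow_succ']
    simp [Polynomial.aeval_monomial, Algebra.algebraMap_eq_smul_one, this]

theorem cfc_diagonal (f : ℝ → ℝ) (d : n → ℝ) :
    cfc f (diagonal (fun i => (d i : ℂ))) = diagonal fun i => (f (d i) : ℂ) := by
  have hD : (diagonal (fun i => (d i : ℂ))).IsHermitian := by
    simp [IsHermitian, diagonal_conjTranspose, Pi.star_def]
  ext i j
  -- The `j`-th basis vector intertwines the diagonal matrix with the scalar `d j`.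
  have hc := cfc_mul_of_intertwine f (L := algebraMap ℝ (Matrix Unit Unit ℂ) (d j))
    (K := Matrix.of fun k _ => if k = j then 1 else 0) hD
    (by ext; simp [algebraMap_matrix_apply])
    (by ext k; simp [Matrix.mul_apply, diagonal_apply, algebraMap_matrix_apply]; aesop)
  rw [cfc_algebraMap] at hc
  have := congr_fun₂ hc i ()
  simp [Matrix.mul_apply, algebraMap_matrix_apply, diagonal_apply] at this ⊢
  rw [this]; aesop

theorem cfc_conj_diagonal (f : ℝ → ℝ) {H W V : Matrix n n ℂ} {d : n → ℝ} (hH : H.IsHermitian)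
    (hWV : W * V = 1) (h : H = W * diagonal (fun i => (d i : ℂ)) * V) :
    cfc f H = W * diagonal (fun i => (f (d i) : ℂ)) * V := by
  have hD : (diagonal (fun i => (d i : ℂ))).IsHermitian := by
    simp [IsHermitian, diagonal_conjTranspose, Pi.star_def]
  have hVW : V * W = 1 := mul_eq_one_comm.mp hWV
  have hc := cfc_mul_of_intertwine f (K := W) hH hD
    (by rw [h, Matrix.mul_assoc _ V, hVW, Matrix.mul_one])
  rw [← cfc_diagonal, ← hc, Matrix.mul_assoc, hWV, Matrix.mul_one]

/-- The spectral decomposition of a Hermitian matrix, in a form convenient for traces. -/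
theorem Matrix.IsHermitian.exists_eq_conj_diagonal {H : Matrix n n ℂ} (hH : H.IsHermitian) :
    ∃ U : Matrix n n ℂ, U * Uᴴ = 1 ∧
      H = U * diagonal (fun i => (hH.eigenvalues i : ℂ)) * Uᴴ := by
  refine ⟨hH.eigenvectorUnitary, ?_, ?_⟩
  · exact Unitary.coe_mul_star_self hH.eigenvectorUnitary
  · conv_lhs => rw [hH.spectral_theorem]
    rfl

theorem cfc_transpose (f : ℝ → ℝ) {H : Matrix n n ℂ} (hH : H.IsHermitian) :
    cfc f Hᵀ = (cfc f H)ᵀ := by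
  obtain ⟨U, hU, h⟩ := hH.exists_eq_conj_diagonal
  have hVW : Uᴴ * U = 1 := mul_eq_one_comm.mp hU
  rw [cfc_conj_diagonal f hH hU h]
  rw [cfc_conj_diagonal (W := Uᴴᵀ) (V := Uᵀ) (d := hH.eigenvalues) f hH.transpose]
  · simp [Matrix.mul_assoc]
  · rw [← transpose_mul, hU, transpose_one]
  · conv_lhs => rw [h]
    simp [Matrix.mul_assoc]

/-- The logarithm of a tensor product; as the logarithm of the singular factor `V` is taken on its
support, the other term carries the support projection of `V`. -/
theorem mlog_kronecker {U : Matrix m m ℂ} {V : Matrix n n ℂ} (hU : U.PosDef) (hV : V.PosSemidef) :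
    mlog (U ⊗ₖ V) = mlog U ⊗ₖ cfc (fun x : ℝ => if x = 0 then 0 else 1) V +
      (1 : Matrix m m ℂ) ⊗ₖ mlog V := by
  obtain ⟨W, hW, h⟩ := hU.isHermitian.exists_eq_conj_diagonal
  obtain ⟨X, hX, h'⟩ := hV.isHermitian.exists_eq_conj_diagonal
  unfold mlog
  rw [cfc_conj_diagonal _ hU.isHermitian hW h, cfc_conj_diagonal _ hV.isHermitian hX h',
    cfc_conj_diagonal _ hV.isHermitian hX h',
    cfc_conj_diagonal (W := W ⊗ₖ X) (V := Wᴴ ⊗ₖ Xᴴ)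
      (d := fun i => hU.isHermitian.eigenvalues i.1 * hV.isHermitian.eigenvalues i.2)
      _ (hU.posSemidef.kronecker hV).isHermitian]
  · have : (1 : Matrix m m ℂ) = W * diagonal (fun _ => 1) * Wᴴ := by simp [hW]
    rw [this]
    simp only [mul_kronecker_mul, diagonal_kronecker_diagonal, ← Matrix.mul_add, ← Matrix.add_mul,
      diagonal_add]
    congr 3
    funext i
    have hi := hU.eigenvalues_pos i.1
    by_cases h0 : hV.isHermitian.eigenvalues i.2 = 0
    · simp [h0]
    · simp [h0, Real.log_mul hi.ne' h0]
  · rw [← mul_kronecker_mul, hW, hX, one_kronecker_one]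
  · conv_lhs => rw [h, h']
    simp [mul_kronecker_mul, diagonal_kronecker_diagonal]

end FunctionalCalculus

/-! ### Square roots, inverses and logarithms on the support -/

section Powers

variable {m n : Type*} [Fintype m] [DecidableEq m] [Fintype n] [DecidableEq n]

theorem isHermitian_cfc (f : ℝ → ℝ) (M : Matrix n n ℂ) : (cfc f M).IsHermitian :=
  cfc_predicate f M

theorem cfc_mul_cfc (f g : ℝ → ℝ) (M : Matrix n n ℂ) :
    cfc f M * cfc g M = cfc (fun x => f x * g x) M :=
  (cfc_mul f g M (continuousOn_spectrum_matrix f M) (continuousOn_spectrum_matrix g M)).symm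

theorem cfc_id_of_isHermitian {M : Matrix n n ℂ} (hM : M.IsHermitian) :
    cfc (fun x : ℝ => x) M = M :=
  cfc_id' ℝ M hM.isSelfAdjoint

theorem cfc_one_of_isHermitian {M : Matrix n n ℂ} (hM : M.IsHermitian) :
    cfc (fun _ : ℝ => (1 : ℝ)) M = 1 :=
  cfc_const_one ℝ M hM.isSelfAdjoint

theorem cfc_eq_cfc_of_nonneg {f g : ℝ → ℝ} {M : Matrix n n ℂ} (hM : M.PosSemidef)
    (h : ∀ x, 0 ≤ x → f x = g x) : cfc f M = cfc g M := by
  refine cfc_congr fun x hx => h x ?_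
  rw [hM.isHermitian.spectrum_real_eq_range_eigenvalues] at hx
  obtain ⟨i, rfl⟩ := hx
  exact hM.eigenvalues_nonneg i

theorem cfc_eq_cfc_of_pos {f g : ℝ → ℝ} {M : Matrix n n ℂ} (hM : M.PosDef)
    (h : ∀ x, 0 < x → f x = g x) : cfc f M = cfc g M := by
  refine cfc_congr fun x hx => h x ?_
  rw [hM.isHermitian.spectrum_real_eq_range_eigenvalues] at hx
  obtain ⟨i, rfl⟩ := hx
  exact hM.eigenvalues_pos i

theorem isHermitian_msqrt (M : Matrix n n ℂ) : (msqrt M).IsHermitian := isHermitian_cfc _ M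

theorem isHermitian_minvSqrt (M : Matrix n n ℂ) : (minvSqrt M).IsHermitian := isHermitian_cfc _ M

theorem isHermitian_minv (M : Matrix n n ℂ) : (minv M).IsHermitian := isHermitian_cfc _ M

theorem msqrt_mul_msqrt {M : Matrix n n ℂ} (hM : M.PosSemidef) : msqrt M * msqrt M = M := by
  conv_rhs => rw [← cfc_id_of_isHermitian hM.isHermitian]
  rw [msqrt, cfc_mul_cfc]
  exact cfc_eq_cfc_of_nonneg hM fun x hx => Real.mul_self_sqrt hx

theorem minvSqrt_mul_minvSqrt {M : Matrix n n ℂ} (hM : M.PosSemidef) :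
    minvSqrt M * minvSqrt M = minv M := by
  rw [minvSqrt, minv, cfc_mul_cfc]
  exact cfc_eq_cfc_of_nonneg hM fun x hx => by rw [← mul_inv, Real.mul_self_sqrt hx]

theorem mul_minv_eq {M : Matrix n n ℂ} (hM : M.IsHermitian) :
    M * minv M = cfc (fun x : ℝ => x * x⁻¹) M := by
  rw [minv, ← cfc_mul_cfc (fun x : ℝ => x), cfc_id_of_isHermitian hM]

theorem isHermitian_mul_minv {M : Matrix n n ℂ} (hM : M.IsHermitian) :
    (M * minv M).IsHermitian := by
  rw [mul_minv_eq hM]; exact isHermitian_cfc _ M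

theorem mul_minv_comm {M : Matrix n n ℂ} (hM : M.IsHermitian) : M * minv M = minv M * M := by
  have h := (isHermitian_mul_minv hM).eq
  rwa [conjTranspose_mul, hM.eq, (isHermitian_minv M).eq, eq_comm] at h

theorem mul_minv_mul {M : Matrix n n ℂ} (hM : M.IsHermitian) : M * minv M * M = M := by
  calc M * minv M * M = cfc (fun x : ℝ => x * x⁻¹ * x) M := by
        rw [mul_minv_eq hM, ← cfc_mul_cfc _ fun x : ℝ => x, cfc_id_of_isHermitian hM]
    _ = M := by simp [cfc_id_of_isHermitian hM]

theorem msqrt_mul_minvSqrt {M : Matrix n n ℂ} (hM : M.PosSemidef) :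
    msqrt M * minvSqrt M = M * minv M := by
  rw [msqrt, minvSqrt, cfc_mul_cfc, mul_minv_eq hM.isHermitian]
  refine cfc_eq_cfc_of_nonneg hM fun x hx => ?_
  rcases hx.eq_or_lt with rfl | hx
  · simp
  · rw [mul_inv_cancel₀ hx.ne', mul_inv_cancel₀ (Real.sqrt_pos.mpr hx).ne']

theorem Matrix.PosDef.mul_minv {M : Matrix n n ℂ} (hM : M.PosDef) : M * minv M = 1 := by
  rw [mul_minv_eq hM.isHermitian, cfc_eq_cfc_of_pos (g := fun _ => 1) hM fun x hx =>
    mul_inv_cancel₀ hx.ne', cfc_one_of_isHermitian hM.isHermitian]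

theorem Matrix.PosDef.msqrt_mul_minvSqrt {M : Matrix n n ℂ} (hM : M.PosDef) :
    msqrt M * minvSqrt M = 1 := by
  rw [_root_.msqrt_mul_minvSqrt hM.posSemidef, hM.mul_minv]

theorem mlog_minv (M : Matrix n n ℂ) (hM : M.IsHermitian) : mlog (minv M) = -mlog M := by
  rw [mlog, minv, mlog, ← cfc_neg, ← cfc_comp' Real.log (fun x => x⁻¹) M
    (((finite_real_spectrum (A := M)).image _).continuousOn _)
    (continuousOn_spectrum_matrix _ M) hM.isSelfAdjoint]
  simp

end Powers

/-! ### Klein's inequality and the Belavkin–Staszewski relative entropy -/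

section RelativeEntropy

variable {m n : Type*} [Fintype m] [DecidableEq m] [Fintype n] [DecidableEq n]

/-- If `P = X Xᴴ` is supported in `Q`, then with `f x = x log x` both forms
`Tr[P log (√P Q⁻¹ √P)]` (take `X = √P`) and `Tr[Xᴴ X log (Xᴴ Q⁻¹ X)]` equal
`Tr[Q f(Q^(-1/2) P Q^(-1/2))]`, which depends on `X` only through `P`. No polar decomposition of
`X` is needed. -/
theorem trace_mul_mlog_eq {Q : Matrix n n ℂ} (hQ : Q.PosSemidef) {X : Matrix n m ℂ}
    (hX : Q * minv Q * X = X) :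
    (Xᴴ * X * mlog (Xᴴ * minv Q * X)).trace =
      (Q * cfc (fun x => x * Real.log x) (minvSqrt Q * (X * Xᴴ) * minvSqrt Q)).trace := by
  set T := minvSqrt Q with hT
  set S := msqrt Q with hS
  have hTh : Tᴴ = T := isHermitian_minvSqrt Q
  have hSh : Sᴴ = S := isHermitian_msqrt Q
  have hSS : S * S = Q := msqrt_mul_msqrt hQ
  obtain ⟨K, hK⟩ : ∃ K, K = T * X := ⟨_, rfl⟩
  have hKK : Xᴴ * minv Q * X = Kᴴ * K := by
    rw [hK, conjTranspose_mul, hTh, ← minvSqrt_mul_minvSqrt hQ]; simp only [Matrix.mul_assoc, hT]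
  have hKK' : T * (X * Xᴴ) * T = K * Kᴴ := by
    rw [hK, conjTranspose_mul, hTh]; simp only [Matrix.mul_assoc]
  have hXK : X = S * K := by
    rw [hK, ← Matrix.mul_assoc, msqrt_mul_minvSqrt hQ, hX]
  have h1 := (posSemidef_conjTranspose_mul_self K).isHermitian
  have h2 := (posSemidef_self_mul_conjTranspose K).isHermitian
  have hint : mlog (K * Kᴴ) * K = K * mlog (Kᴴ * K) :=
    cfc_mul_of_intertwine Real.log h2 h1 (Matrix.mul_assoc _ _ _)
  have hf : cfc (fun x => x * Real.log x) (K * Kᴴ) = mlog (K * Kᴴ) * (K * Kᴴ) := by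
    rw [show (fun x => x * Real.log x) = fun x => Real.log x * x from funext fun x => mul_comm _ _,
      ← cfc_mul_cfc, cfc_id_of_isHermitian h2, mlog]
  rw [hKK, hKK', hf, ← Matrix.mul_assoc (mlog _), hint, Matrix.mul_assoc Xᴴ, trace_mul_comm]
  conv_lhs => rw [hXK]
  rw [conjTranspose_mul, hSh, ← hSS, Matrix.mul_assoc S S, trace_mul_comm S]
  simp only [Matrix.mul_assoc]

/-- Traces of products of functions of two Hermitian matrices, in terms of the matrix `K` of `S`
with respect to their eigenbases. -/
theorem Matrix.IsHermitian.exists_trace_eq_sum {M N : Matrix n n ℂ} (hM : M.IsHermitian)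
    (hN : N.IsHermitian) (S : Matrix n n ℂ) :
    ∃ K : Matrix n n ℂ,
      (∀ g h : ℝ → ℝ, (Sᴴ * cfc g M * S * cfc h N).trace.re =
        ∑ k, ∑ j, g (hM.eigenvalues j) * h (hN.eigenvalues k) * Complex.normSq (K j k)) ∧
      (M * S = S * N ↔ ∀ j k, hM.eigenvalues j = hN.eigenvalues k ∨ K j k = 0) := by
  obtain ⟨U, hU, hMU⟩ := hM.exists_eq_conj_diagonal
  obtain ⟨W, hW, hNW⟩ := hN.exists_eq_conj_diagonal
  have hU' : Uᴴ * U = 1 := mul_eq_one_comm.mp hU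
  have hW' : Wᴴ * W = 1 := mul_eq_one_comm.mp hW
  refine ⟨Uᴴ * S * W, fun g h => ?_, ?_⟩
  · rw [cfc_conj_diagonal g hM hU hMU, cfc_conj_diagonal h hN hW hNW]
    set K := Uᴴ * S * W with hK
    have : (Sᴴ * (U * diagonal (fun i => (g (hM.eigenvalues i) : ℂ)) * Uᴴ) * S *
        (W * diagonal (fun i => (h (hN.eigenvalues i) : ℂ)) * Wᴴ)).trace =
        (Kᴴ * diagonal (fun i => (g (hM.eigenvalues i) : ℂ)) * K *
          diagonal (fun i => (h (hN.eigenvalues i) : ℂ))).trace := by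
      rw [hK, ← Matrix.mul_assoc _ _ Wᴴ, trace_mul_comm _ Wᴴ]
      simp only [conjTranspose_mul, conjTranspose_conjTranspose, Matrix.mul_assoc]
    rw [this]
    simp only [trace, diag_apply, mul_diagonal, Matrix.mul_apply (M := Kᴴ * _),
      conjTranspose_apply, Complex.re_sum, Finset.sum_mul]
    refine Finset.sum_congr rfl fun k _ => Finset.sum_congr rfl fun j _ => ?_
    rw [Complex.normSq_apply]
    simp
    ring
  · have hiff : M * S = S * N ↔
        diagonal (fun i => (hM.eigenvalues i : ℂ)) * (Uᴴ * S * W) =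
          (Uᴴ * S * W) * diagonal (fun i => (hN.eigenvalues i : ℂ)) := by
      set D := diagonal (fun i => (hM.eigenvalues i : ℂ))
      set D' := diagonal (fun i => (hN.eigenvalues i : ℂ))
      have e1 : Uᴴ * (M * S) * W = D * (Uᴴ * S * W) := by
        rw [hMU]; simp only [← Matrix.mul_assoc, hU', Matrix.one_mul]
      have e2 : Uᴴ * (S * N) * W = (Uᴴ * S * W) * D' := by
        rw [hNW]; simp only [Matrix.mul_assoc, hW', Matrix.mul_one]
      rw [← e1, ← e2]
      refine ⟨fun h => by rw [h], fun h => ?_⟩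
      have := congrArg (fun Z => U * Z * Wᴴ) h
      simpa only [Matrix.mul_assoc, hW, Matrix.mul_one, ← Matrix.mul_assoc U Uᴴ, hU,
        Matrix.one_mul] using this
    rw [hiff, ← Matrix.ext_iff]
    refine forall_congr' fun j => forall_congr' fun k => ?_
    rw [diagonal_mul, mul_diagonal, mul_comm, mul_eq_mul_left_iff, Complex.ofReal_inj]

/-- Klein's inequality for `x log x`, with its equality case. In the eigenbases of `M` and `N` the
left-hand side is a sum, with nonnegative weights, of the terms
`m log m - m log n - m + n ≥ 0`, which vanish only for `m = n`. -/
theorem klein_inequality {M N : Matrix n n ℂ} (hM : M.PosSemidef) (hN : N.PosDef)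
    (S : Matrix n n ℂ) :
    0 ≤ (Sᴴ * cfc (fun x => x * Real.log x) M * S).trace.re - (Sᴴ * M * S * mlog N).trace.re
        - (Sᴴ * M * S).trace.re + (Sᴴ * S * N).trace.re ∧
      ((Sᴴ * cfc (fun x => x * Real.log x) M * S).trace.re - (Sᴴ * M * S * mlog N).trace.re
        - (Sᴴ * M * S).trace.re + (Sᴴ * S * N).trace.re = 0 ↔ M * S = S * N) := by
  obtain ⟨K, hK, hiff⟩ := hM.isHermitian.exists_trace_eq_sum hN.isHermitian S
  set μ := hM.isHermitian.eigenvalues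
  set ν := hN.isHermitian.eigenvalues
  have t1 := hK (fun x => x * Real.log x) (fun _ => 1)
  have t2 := hK (fun x => x) Real.log
  have t3 := hK (fun x => x) (fun _ => 1)
  have t4 := hK (fun _ => 1) (fun x => x)
  simp only [cfc_one_of_isHermitian hM.isHermitian, cfc_one_of_isHermitian hN.isHermitian,
    cfc_id_of_isHermitian hM.isHermitian, cfc_id_of_isHermitian hN.isHermitian,
    Matrix.mul_one] at t1 t2 t3 t4
  rw [mlog, t1, t2, t3, t4, hiff]
  simp only [← Finset.sum_sub_distrib, ← Finset.sum_add_distrib]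
  have hterm : ∀ k j, 0 ≤ μ j * Real.log (μ j) - μ j * Real.log (ν k) - μ j + ν k ∧
      (μ j * Real.log (μ j) - μ j * Real.log (ν k) - μ j + ν k = 0 → μ j = ν k) := by
    intro k j
    have hn : 0 < ν k := hN.eigenvalues_pos k
    rcases (hM.eigenvalues_nonneg j).eq_or_lt with h0 | hm
    · change 0 = μ j at h0
      rw [← h0]
      simp only [zero_mul, sub_zero, zero_add]
      exact ⟨hn.le, fun h => h.symm⟩
    · change 0 < μ j at hm
      have hq : 0 < ν k / μ j := div_pos hn hm
      have hlog : Real.log (ν k / μ j) = Real.log (ν k) - Real.log (μ j) :=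
        Real.log_div hn.ne' hm.ne'
      have hdiv : ν k = μ j * (ν k / μ j) := by field_simp
      have key : μ j * Real.log (μ j) - μ j * Real.log (ν k) - μ j + ν k =
          μ j * (ν k / μ j - 1 - Real.log (ν k / μ j)) := by
        rw [hlog, mul_sub, mul_sub, ← hdiv]; ring
      rw [key]
      refine ⟨mul_nonneg hm.le (by linarith [Real.log_le_sub_one_of_pos hq]), fun h => ?_⟩
      by_contra hne
      have h1 : ν k / μ j ≠ 1 := fun h1 => hne (by rw [hdiv, h1, mul_one])
      have := Real.log_lt_sub_one_of_pos hq h1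
      rcases mul_eq_zero.mp h with h | h <;> linarith
  have hsum : ∀ k ∈ (Finset.univ : Finset n), ∀ j ∈ (Finset.univ : Finset n),
      μ j * Real.log (μ j) * 1 * Complex.normSq (K j k) - μ j * Real.log (ν k) *
        Complex.normSq (K j k) - μ j * 1 * Complex.normSq (K j k) + 1 * ν k *
        Complex.normSq (K j k) =
      (μ j * Real.log (μ j) - μ j * Real.log (ν k) - μ j + ν k) * Complex.normSq (K j k) := by
    intros; ring
  rw [Finset.sum_congr rfl fun k hk => Finset.sum_congr rfl (hsum k hk)]
  have hnn : ∀ k j, 0 ≤ (μ j * Real.log (μ j) - μ j * Real.log (ν k) - μ j + ν k) *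
      Complex.normSq (K j k) := fun k j => mul_nonneg (hterm k j).1 (Complex.normSq_nonneg _)
  refine ⟨Finset.sum_nonneg fun k _ => Finset.sum_nonneg fun j _ => hnn k j, ?_⟩
  rw [Finset.sum_eq_zero_iff_of_nonneg fun k _ => Finset.sum_nonneg fun j _ => hnn k j]
  constructor
  · intro h j k
    have := (Finset.sum_eq_zero_iff_of_nonneg fun j _ => hnn k j).mp (h k (Finset.mem_univ k)) j
      (Finset.mem_univ j)
    exact (mul_eq_zero.mp this).imp (hterm k j).2 Complex.normSq_eq_zero.mp
  · intro h k _
    refine Finset.sum_eq_zero fun j _ => ?_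
    rcases h j k with h | h
    · rw [h]; ring
    · rw [h]; simp

end RelativeEntropy

/-! ### Positive matrices and supports -/

section Positivity

variable {l m n : Type*} [Fintype n]

/-- A sum of congruences `Bᵢᴴ C Bᵢ` of a positive definite matrix is positive definite as soon as
the `Bᵢ` have no common kernel vector. -/
theorem Matrix.PosDef.sum_conjTranspose_mul_mul [Fintype l] [Fintype m] {C : Matrix m m ℂ}
    (hC : C.PosDef) (B : l → Matrix m n ℂ) (hB : ∀ v, (∀ i, B i *ᵥ v = 0) → v = 0) :
    (∑ i, (B i)ᴴ * C * B i).PosDef := by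
  have hi : ∀ i, ((B i)ᴴ * C * B i).PosSemidef :=
    fun i => hC.posSemidef.conjTranspose_mul_mul_same (B i)
  have hform : ∀ i v, star v ⬝ᵥ (((B i)ᴴ * C * B i) *ᵥ v) =
      star (B i *ᵥ v) ⬝ᵥ (C *ᵥ (B i *ᵥ v)) := by
    intro i v
    rw [← mulVec_mulVec, ← mulVec_mulVec, dotProduct_mulVec, star_mulVec]
  refine .of_dotProduct_mulVec_pos (posSemidef_sum _ fun i _ => hi i).isHermitian fun v hv => ?_
  obtain ⟨i, hne⟩ : ∃ i, B i *ᵥ v ≠ 0 := by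
    by_contra! h
    exact hv (hB v h)
  rw [sum_mulVec, dotProduct_sum]
  refine Finset.sum_pos' (fun i _ => (hi i).dotProduct_mulVec_nonneg v) ⟨i, Finset.mem_univ i, ?_⟩
  rw [hform]
  exact hC.dotProduct_mulVec_pos hne

theorem Matrix.PosSemidef.exists_eq_conjTranspose_mul_self [DecidableEq n] {P : Matrix n n ℂ}
    (hP : P.PosSemidef) : ∃ L : Matrix n n ℂ, P = Lᴴ * L :=
  ⟨msqrt P, by rw [(isHermitian_msqrt P).eq, msqrt_mul_msqrt hP]⟩

theorem mul_msqrt_eq_zero [DecidableEq n] {P : Matrix n n ℂ} (hP : P.PosSemidef)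
    {F : Matrix m n ℂ} (h : F * P = 0) : F * msqrt P = 0 := by
  rw [← Matrix.self_mul_conjTranspose_eq_zero, conjTranspose_mul, (isHermitian_msqrt P).eq,
    Matrix.mul_assoc, ← Matrix.mul_assoc (msqrt P), msqrt_mul_msqrt hP, ← Matrix.mul_assoc, h,
    Matrix.zero_mul]

theorem SupportLE.exists_eq_mul {P Q : Matrix n n ℂ} (h : SupportLE P Q) :
    ∃ Z : Matrix n n ℂ, P = Q * Z := by
  classical
  have hj : ∀ j, ∃ z, Q *ᵥ z = P *ᵥ Pi.single j 1 := fun j => h ⟨Pi.single j 1, rfl⟩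
  choose z hz using hj
  refine ⟨Matrix.of fun i j => z j i, ?_⟩
  ext i j
  have := congrFun (hz j) i
  rw [mulVec_single_one] at this
  exact this.symm

theorem Matrix.PosDef.minv [DecidableEq n] {N : Matrix n n ℂ} (hN : N.PosDef) :
    (minv N).PosDef := by
  rw [← Matrix.inv_eq_right_inv hN.mul_minv]
  exact hN.inv

end Positivity

/-! ### The Choi operator -/

section Choi

theorem choi_apply {a b : Type*} [Fintype a] [DecidableEq a]
    (E : Matrix a a ℂ →ₗ[ℂ] Matrix b b ℂ) (p q : b) (i j : a) :
    choi E (p, i) (q, j) = E (single i j 1) p q := by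
  simp only [choi, Matrix.sum_apply, kronecker_apply]
  rw [Finset.sum_eq_single i, Finset.sum_eq_single j]
  · simp
  · intro k _ hk; simp [single, hk]
  · simp
  · intro k _ hk; simp [single, hk]
  · simp

theorem apply_eq_sum_choi {a b : Type*} [Fintype a] [DecidableEq a]
    (E : Matrix a a ℂ →ₗ[ℂ] Matrix b b ℂ) (Y : Matrix a a ℂ) (p q : b) :
    E Y p q = ∑ i, ∑ j, Y i j * choi E (p, i) (q, j) := by
  have h : Y = ∑ i, ∑ j, Y i j • single i j (1 : ℂ) := by
    conv_lhs => rw [matrix_eq_sum_single Y]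
    simp
  conv_lhs => rw [h]
  simp only [choi_apply, map_sum, map_smul, Matrix.sum_apply, Matrix.smul_apply, smul_eq_mul]

variable {a b c : Type*} [Fintype a] [DecidableEq a] [Fintype b] [Fintype c]

theorem trace_choi_mul (E : Matrix a a ℂ →ₗ[ℂ] Matrix b b ℂ) (X : Matrix b b ℂ)
    (Y : Matrix a a ℂ) : (choi E * (X ⊗ₖ Yᵀ)).trace = (E Y * X).trace := by
  simp only [trace, diag_apply, Matrix.mul_apply, Fintype.sum_prod_type, kronecker_apply,
    transpose_apply, apply_eq_sum_choi, Finset.sum_mul]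
  refine Finset.sum_congr rfl fun p _ => ?_
  rw [Finset.sum_comm]
  refine Finset.sum_congr rfl fun q _ => Finset.sum_congr rfl fun i _ =>
    Finset.sum_congr rfl fun j _ => ?_
  ring

/-- The Choi operator is the image under `E ⊗ id` of the unnormalized maximally entangled state. -/
theorem IsChannel.posSemidef_choi {E : Matrix a a ℂ →ₗ[ℂ] Matrix b b ℂ} (hE : IsChannel E) :
    (choi E).PosSemidef := by
  let e := Fintype.equivFin a
  let v : a × Fin (Fintype.card a) → ℂ := fun x => if e x.1 = x.2 then 1 else 0
  have h := hE.completelyPositive _ _ (posSemidef_vecMulVec_self_star v)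
  have hC : choi E = (ampliation _ E (vecMulVec v (star v))).submatrix
      (fun x => (x.1, e x.2)) (fun x => (x.1, e x.2)) := by
    ext ⟨p, i⟩ ⟨q, j⟩
    rw [choi_apply]
    simp only [ampliation, submatrix_apply, of_apply]
    suffices single i j (1 : ℂ) =
        of fun s t => vecMulVec v (star v) (s, e i) (t, e j) by rw [this]
    ext s t
    by_cases hs : i = s <;> by_cases ht : j = t <;>
      simp [vecMulVec_apply, v, single, eq_comm, hs, ht]
  rw [hC]
  exact h.submatrix _

variable [DecidableEq b] [DecidableEq c]

theorem IsChannel.posDef_choi {E : Matrix a a ℂ →ₗ[ℂ] Matrix b b ℂ} (hE : IsChannel E)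
    (hr : FullRank E) : (choi E).PosDef := by
  rw [hE.posSemidef_choi.posDef_iff_isUnit, ← mulVec_surjective_iff_isUnit]
  have h : LinearMap.range (choi E).mulVecLin = ⊤ := by
    apply Submodule.eq_top_of_finrank_eq
    rw [Module.finrank_fintype_fun_eq_card]
    exact hr
  exact LinearMap.range_eq_top.mp h

/-- A map with positive definite Choi operator sends nonzero positive operators to positive definite
ones. -/
theorem posDef_apply {E : Matrix a a ℂ →ₗ[ℂ] Matrix b b ℂ} (hC : (choi E).PosDef)
    {γ : Matrix a a ℂ} (hγ : γ.PosSemidef) (h0 : γ ≠ 0) : (E γ).PosDef := by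
  obtain ⟨L, rfl⟩ := hγ.exists_eq_conjTranspose_mul_self
  have hL : ∃ k i, L k i ≠ 0 := by
    by_contra! h
    exact h0 (by rw [show L = 0 from Matrix.ext h, Matrix.mul_zero])
  obtain ⟨k, i, hki⟩ := hL
  have hE : E (Lᴴ * L) =
      ∑ k, (Matrix.of fun (x : b × a) (q : b) => if x.1 = q then L k x.2 else 0)ᴴ * choi E *
        (Matrix.of fun (x : b × a) (q : b) => if x.1 = q then L k x.2 else 0) := by
    ext p q
    rw [apply_eq_sum_choi, Matrix.sum_apply]
    simp only [Matrix.mul_apply, conjTranspose_apply, of_apply, Fintype.sum_prod_type,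
      Finset.sum_mul, apply_ite star, star_zero, ite_mul, zero_mul, mul_ite, mul_zero]
    simp only [Finset.sum_ite_irrel, Finset.sum_const_zero, Finset.sum_ite_eq', Finset.mem_univ,
      if_true]
    rw [Finset.sum_comm_cycle]
    refine Finset.sum_congr rfl fun k _ => ?_
    rw [Finset.sum_comm]
    refine Finset.sum_congr rfl fun j _ => Finset.sum_congr rfl fun i _ => ?_
    ring
  rw [hE]
  refine hC.sum_conjTranspose_mul_mul _ fun v hv => ?_
  ext p
  have := congrFun (hv k) (p, i)
  simpa [mulVec, dotProduct, hki] using this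

/-- The Choi operator of a composition is the link product
`∑ₖ (1 ⊗ Lₖ)ᴴ C₂ (1 ⊗ Lₖ)` of the two Choi operators, where the `Lₖ` are the rows of a factor `L` of
`C₁ = Lᴴ L`. -/
theorem posDef_choi_comp [Nonempty b] {E₁ : Matrix a a ℂ →ₗ[ℂ] Matrix b b ℂ}
    {E₂ : Matrix b b ℂ →ₗ[ℂ] Matrix c c ℂ}
    (h₁ : (choi E₁).PosDef) (h₂ : (choi E₂).PosDef) : (choi (E₂ ∘ₗ E₁)).PosDef := by
  obtain ⟨L, hL⟩ := h₁.posSemidef.exists_eq_conjTranspose_mul_self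
  have hE : choi (E₂ ∘ₗ E₁) = ∑ k, ((1 : Matrix c c ℂ) ⊗ₖ Matrix.of fun q j => L k (q, j))ᴴ *
      choi E₂ * ((1 : Matrix c c ℂ) ⊗ₖ Matrix.of fun q j => L k (q, j)) := by
    ext ⟨r, i⟩ ⟨s, j⟩
    rw [choi_apply, LinearMap.comp_apply, apply_eq_sum_choi, Matrix.sum_apply]
    simp only [← choi_apply E₁]
    rw [hL]
    simp only [Matrix.mul_apply, conjTranspose_apply, of_apply, Fintype.sum_prod_type,
      kronecker_apply, Matrix.one_apply,
      Finset.sum_mul, apply_ite star, star_zero, ite_mul, zero_mul, mul_ite, mul_zero, one_mul]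
    simp only [Finset.sum_ite_irrel, Finset.sum_const_zero, Finset.sum_ite_eq', Finset.mem_univ,
      if_true]
    rw [Finset.sum_comm_cycle]
    refine Finset.sum_congr rfl fun k _ => ?_
    rw [Finset.sum_comm_cycle]
    refine Finset.sum_congr rfl fun l _ => ?_
    rw [Finset.sum_comm]
    refine Finset.sum_congr rfl fun q _ => Finset.sum_congr rfl fun p _ => ?_
    ring
  rw [hE]
  refine h₂.sum_conjTranspose_mul_mul _ fun v hv => ?_
  have hLu : Function.Injective L.mulVec := by
    apply mulVec_injective_of_isUnit
    have := h₁.isUnit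
    rw [hL] at this
    exact isUnit_of_mul_isUnit_right this
  ext ⟨s, j⟩
  obtain ⟨p⟩ := ‹Nonempty b›
  -- `hv` says that `L` annihilates the vectors `p ⊗ v (s, ·)`.
  have h0 : L *ᵥ (fun x => if x.1 = p then v (s, x.2) else 0) = L *ᵥ 0 := by
    ext k
    have := congrFun (hv k) (s, p)
    simpa [mulVec, dotProduct, Fintype.sum_prod_type, Matrix.one_apply] using this
  simpa using congrFun (hLu h0) (p, j)

end Choi

/-! ### The average entropy production of a process -/

/-! ### The average entropy production of a process -/

section EntropyProduction

variable {a b : Type*} [Fintype a] [DecidableEq a] [Fintype b] [DecidableEq b]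

theorem posSemidef_minv {M : Matrix a a ℂ} (hM : M.PosSemidef) : (minv M).PosSemidef := by
  rw [← minvSqrt_mul_minvSqrt hM]
  conv in minvSqrt M * _ => lhs; rw [← (isHermitian_minvSqrt M).eq]
  exact posSemidef_conjTranspose_mul_self _

theorem posSemidef_minvSqrt_mul_mul (G : Matrix a a ℂ) {τ : Matrix a a ℂ} (hτ : τ.PosSemidef) :
    (minvSqrt G * τ * minvSqrt G).PosSemidef := by
  have := hτ.conjTranspose_mul_mul_same (minvSqrt G)
  rwa [(isHermitian_minvSqrt G).eq] at this

/-- The support of `√P Q⁻¹ √P` is that of `P` when `P` is supported in `Q`. -/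
theorem msqrt_mul_supportProj {P Q : Matrix a a ℂ} (hQ : Q.PosSemidef)
    (h : msqrt P * (Q * minv Q) = msqrt P) :
    msqrt P * cfc (fun x : ℝ => if x = 0 then 0 else 1) (msqrt P * minv Q * msqrt P) = msqrt P := by
  set r := msqrt P
  set V := r * minv Q * r with hV
  set χ := cfc (fun x : ℝ => if x = 0 then 0 else (1 : ℝ)) V with hχ
  have hr : rᴴ = r := isHermitian_msqrt P
  have hVK : V = (minvSqrt Q * r)ᴴ * (minvSqrt Q * r) := by
    rw [hV, ← minvSqrt_mul_minvSqrt hQ, conjTranspose_mul, hr, (isHermitian_minvSqrt Q).eq]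
    simp only [Matrix.mul_assoc]
  have hVh : V.IsHermitian := by
    rw [hVK]; exact (posSemidef_conjTranspose_mul_self _).isHermitian
  have hVχ : V * χ = V := by
    calc V * cfc (fun x : ℝ => if x = 0 then 0 else (1 : ℝ)) V
        = cfc (fun x : ℝ => x * if x = 0 then 0 else (1 : ℝ)) V := by
          rw [← cfc_mul_cfc fun x : ℝ => x, cfc_id_of_isHermitian hVh]
      _ = cfc (fun x : ℝ => x) V := by congr 1; funext x; split_ifs with hx <;> simp [hx]
      _ = V := cfc_id_of_isHermitian hVh
  have h0 : minvSqrt Q * r * (1 - χ) = 0 := by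
    rw [← conjTranspose_mul_self_mul_eq_zero, ← hVK, Matrix.mul_sub, hVχ, Matrix.mul_one, sub_self]
  have h' : Q * minv Q * r = r := by
    have := congrArg conjTranspose h
    rwa [conjTranspose_mul, hr, (isHermitian_mul_minv hQ.isHermitian).eq] at this
  have h1 : r * (1 - χ) = 0 := by
    rw [← h', ← msqrt_mul_minvSqrt hQ, Matrix.mul_assoc, Matrix.mul_assoc, ← Matrix.mul_assoc _ r,
      h0, Matrix.mul_zero]
  rw [Matrix.mul_sub, Matrix.mul_one, sub_eq_zero] at h1
  exact h1.symm

/-- The support condition on the process operators says that the reverse input is invertible (first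
part, stated for its congruence `N`), and that `ρ` is supported in `γ` (second part). -/
theorem supports_of_supportLE [Nonempty b] {C : Matrix (b × a) (b × a) ℂ} (hC : C.PosDef)
    {ρ γ : Matrix a a ℂ} {N : Matrix b b ℂ} (hρ : ρ ≠ 0) (hN : N.IsHermitian) (hγ : γ.IsHermitian)
    (h : SupportLE (msqrt C * ((1 : Matrix b b ℂ) ⊗ₖ ρᵀ) * msqrt C)
      (msqrt C * (N ⊗ₖ γᵀ) * msqrt C)) :
    N * minv N = 1 ∧ ρ * (γ * minv γ) = ρ := by
  obtain ⟨Z, hZ⟩ := h.exists_eq_mul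
  set S := msqrt C
  have hST : S * minvSqrt C = 1 := hC.msqrt_mul_minvSqrt
  have hTS : minvSqrt C * S = 1 := mul_eq_one_comm.mp hST
  have hA : (1 : Matrix b b ℂ) ⊗ₖ ρᵀ = (N ⊗ₖ γᵀ) * (S * Z * minvSqrt C) := by
    have := congrArg (fun Y => minvSqrt C * Y * minvSqrt C) hZ
    simpa only [Matrix.mul_assoc, hST, Matrix.mul_one, ← Matrix.mul_assoc (minvSqrt C) S, hTS,
      Matrix.one_mul] using this
  constructor
  · have h0 : (1 - N * minv N) ⊗ₖ ρᵀ = 0 := by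
      have := congrArg (fun Y => ((1 - N * minv N) ⊗ₖ (1 : Matrix a a ℂ)) * Y) hA
      simpa only [← Matrix.mul_assoc, ← mul_kronecker_mul, Matrix.sub_mul, mul_minv_mul hN,
        Matrix.one_mul, Matrix.mul_one, sub_self, zero_kronecker, Matrix.zero_mul] using this
    obtain ⟨i, j, hij⟩ : ∃ i j, ρ i j ≠ 0 := by
      by_contra! h
      exact hρ (Matrix.ext h)
    symm
    rw [← sub_eq_zero]
    ext p q
    have := congrFun₂ h0 (p, j) (q, i)
    simpa [hij] using this
  · have h0 : (1 : Matrix b b ℂ) ⊗ₖ ((1 - (γ * minv γ)ᵀ) * ρᵀ) = 0 := by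
      have := congrArg (fun Y => ((1 : Matrix b b ℂ) ⊗ₖ (1 - (γ * minv γ)ᵀ)) * Y) hA
      have hz : (1 - (γ * minv γ)ᵀ) * γᵀ = 0 := by
        rw [Matrix.sub_mul, Matrix.one_mul, ← transpose_mul, mul_minv_comm hγ, ← Matrix.mul_assoc,
          mul_minv_mul hγ, sub_self]
      simpa only [← Matrix.mul_assoc, ← mul_kronecker_mul, hz, Matrix.one_mul,
        kronecker_zero, Matrix.zero_mul] using this
    have h1 : (1 - (γ * minv γ)ᵀ) * ρᵀ = 0 := by
      obtain ⟨p⟩ := ‹Nonempty b›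
      ext i j
      simpa using congrFun₂ h0 (p, i) (p, j)
    rw [Matrix.sub_mul, Matrix.one_mul, ← transpose_mul, sub_eq_zero] at h1
    exact (transpose_injective h1).symm

/-- The average entropy production splits into a term for the input, which is independent of the
channel, and a term for the output. -/
theorem avgEntropyProduction_eq {E : Matrix a a ℂ →ₗ[ℂ] Matrix b b ℂ} (hC : (choi E).PosDef)
    (htr : ∀ M, (E M).trace = M.trace) {ρ γ : Matrix a a ℂ} {τ : Matrix b b ℂ}
    (hρ : ρ.PosSemidef) (hγ : γ.PosSemidef)
    (hN : (minvSqrt (E γ) * τ * minvSqrt (E γ)).PosDef) (hs : ρ * (γ * minv γ) = ρ) :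
    avgEntropyProduction E ρ γ τ = (ρ * mlog (msqrt ρ * minv γ * msqrt ρ)).trace.re -
      (E ρ * mlog (minvSqrt (E γ) * τ * minvSqrt (E γ))).trace.re := by
  set N := minvSqrt (E γ) * τ * minvSqrt (E γ) with hNdef
  set C := choi E with hCdef
  set r := msqrt ρ with hr
  set S := msqrt C with hS
  have hrh : rᴴ = r := isHermitian_msqrt ρ
  have hrr : r * r = ρ := msqrt_mul_msqrt hρ
  have hSh : Sᴴ = S := isHermitian_msqrt C
  have hSS : S * S = C := msqrt_mul_msqrt hC.posSemidef
  have hST : S * minvSqrt C = 1 := hC.msqrt_mul_minvSqrt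
  have hTS : minvSqrt C * S = 1 := mul_eq_one_comm.mp hST
  have hrs' : γ * minv γ * r = r := by
    have h1 : (1 - γ * minv γ) * ρ = 0 := by
      have := congrArg conjTranspose hs
      rw [conjTranspose_mul, hρ.isHermitian.eq, (isHermitian_mul_minv hγ.isHermitian).eq] at this
      rw [Matrix.sub_mul, Matrix.one_mul, this, sub_self]
    have := mul_msqrt_eq_zero hρ h1
    rw [Matrix.sub_mul, Matrix.one_mul, sub_eq_zero] at this
    exact this.symm
  have hrs : r * (γ * minv γ) = r := by
    have := congrArg conjTranspose hrs'
    rwa [conjTranspose_mul, hrh, (isHermitian_mul_minv hγ.isHermitian).eq] at this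
  -- The square root `A` of `1 ⊗ ρᵀ`, the middle factor `B` of the reverse operator and its inverse
  -- `B'` on its support.
  obtain ⟨A, hA⟩ : ∃ A, A = (1 : Matrix b b ℂ) ⊗ₖ rᵀ := ⟨_, rfl⟩
  obtain ⟨B, hB⟩ : ∃ B, B = N ⊗ₖ γᵀ := ⟨_, rfl⟩
  obtain ⟨B', hB'⟩ : ∃ B', B' = minv N ⊗ₖ (minv γ)ᵀ := ⟨_, rfl⟩
  have hAh : Aᴴ = A := by
    rw [hA, conjTranspose_kronecker, conjTranspose_one, (show rᵀᴴ = rᵀ from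
      (isHermitian_msqrt ρ).transpose)]
  have hBp : B.PosSemidef := hB ▸ hN.posSemidef.kronecker hγ.transpose
  have hB'h : B'ᴴ = B' := by
    rw [hB', conjTranspose_kronecker, (isHermitian_minv N).eq,
      (isHermitian_minv γ).transpose.eq]
  have hBA : B * (B' * A) = A := by
    rw [hA, hB, hB', ← mul_kronecker_mul, ← mul_kronecker_mul, ← transpose_mul, ← transpose_mul,
      Matrix.mul_one, hN.mul_minv, Matrix.mul_assoc, ← mul_minv_comm hγ.isHermitian, hrs]
  have hP : forwardOp E ρ = (S * A) * (S * A)ᴴ := by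
    rw [forwardOp, conjTranspose_mul, hAh, hSh, hA, ← hrr, transpose_mul]
    rw [← Matrix.one_mul (1 : Matrix b b ℂ), mul_kronecker_mul, Matrix.one_mul]
    simp only [Matrix.mul_assoc, hS, hCdef]
  have hQ : reverseOp E γ τ = S * B * S := by rw [reverseOp, hB]
  set Q := reverseOp E γ τ
  have hQp : Q.PosSemidef := by
    rw [hQ]
    have := hBp.conjTranspose_mul_mul_same S
    rwa [hSh] at this
  have hW : S * A = Q * (minvSqrt C * (B' * A)) := by
    rw [hQ, Matrix.mul_assoc, ← Matrix.mul_assoc S (minvSqrt C), hST, Matrix.one_mul,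
      Matrix.mul_assoc, hBA]
  set W := minvSqrt C * (B' * A) with hWdef
  have hX : Q * minv Q * (S * A) = S * A := by
    rw [hW, ← Matrix.mul_assoc, mul_minv_mul hQp.isHermitian]
  set P := forwardOp E ρ
  have hPp : P.PosSemidef := hP ▸ posSemidef_self_mul_conjTranspose _
  have hPQ : Q * minv Q * msqrt P = msqrt P := by
    have h1 : (1 - Q * minv Q) * P = 0 := by
      rw [Matrix.sub_mul, Matrix.one_mul, hP, ← Matrix.mul_assoc _ (S * A), hX, sub_self]
    have := mul_msqrt_eq_zero hPp h1
    rw [Matrix.sub_mul, Matrix.one_mul, sub_eq_zero] at this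
    exact this.symm
  -- `P = (S A)(S A)ᴴ`, so `√P` may be replaced by `S A`.
  have hswap : (P * entropyProductionOp P Q).trace =
      ((S * A)ᴴ * (S * A) * mlog ((S * A)ᴴ * minv Q * (S * A))).trace := by
    rw [trace_mul_mlog_eq hQp hX, ← hP]
    have := trace_mul_mlog_eq hQp hPQ
    rwa [(isHermitian_msqrt P).eq, msqrt_mul_msqrt hPp] at this
  set V := r * minv γ * r with hV
  have hVp : V.PosSemidef := by
    have := (posSemidef_minv hγ).conjTranspose_mul_mul_same r
    rwa [hrh] at this
  have harg : (S * A)ᴴ * minv Q * (S * A) = minv N ⊗ₖ Vᵀ := by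
    have : (S * A)ᴴ * minv Q * (S * A) = A * (B' * A) := by
      have hWW : Wᴴ * Q * W = A * (B' * A) := by
        rw [Matrix.mul_assoc, ← hW, hWdef, conjTranspose_mul, conjTranspose_mul, hAh, hB'h,
          (isHermitian_minvSqrt C).eq]
        rw [Matrix.mul_assoc, ← Matrix.mul_assoc _ S, hTS, Matrix.one_mul, Matrix.mul_assoc]
      rw [← hWW, hW, conjTranspose_mul, hQp.isHermitian.eq, Matrix.mul_assoc, Matrix.mul_assoc,
        ← Matrix.mul_assoc (minv Q), ← Matrix.mul_assoc Q, ← Matrix.mul_assoc Q,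
        mul_minv_mul hQp.isHermitian, Matrix.mul_assoc]
    rw [this, hA, hB', ← mul_kronecker_mul, ← mul_kronecker_mul, Matrix.one_mul, Matrix.mul_one,
      ← transpose_mul, ← transpose_mul]
  have hAA : (S * A)ᴴ * (S * A) = A * C * A := by
    rw [conjTranspose_mul, hAh, hSh, ← hSS]; simp only [Matrix.mul_assoc]
  have htrace : ∀ (X : Matrix b b ℂ) (Y : Matrix a a ℂ),
      (A * C * A * (X ⊗ₖ Yᵀ)).trace = (E (r * Y * r) * X).trace := by
    intro X Y
    rw [← trace_choi_mul, Matrix.mul_assoc, Matrix.mul_assoc, trace_mul_comm, hA, Matrix.mul_assoc,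
      ← mul_kronecker_mul, ← mul_kronecker_mul, Matrix.one_mul, Matrix.mul_one, ← transpose_mul,
      ← transpose_mul, Matrix.mul_assoc]
  rw [avgEntropyProduction, hswap, harg, hAA, mlog_kronecker hN.minv hVp.transpose, mlog,
    mlog, cfc_transpose _ hVp.isHermitian, cfc_transpose _ hVp.isHermitian, Matrix.mul_add,
    trace_add, htrace, htrace, msqrt_mul_supportProj hγ hrs, hrr, Matrix.mul_one, htr,
    trace_mul_cycle r, hrr]
  have := mlog_minv N hN.isHermitian
  unfold mlog at this ⊢
  rw [this]
  simp
  ring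

end EntropyProduction

/-! ### Comparison of measured and Belavkin–Staszewski relative entropies -/

/-! ### Comparison of measured and Belavkin–Staszewski relative entropies -/

section TriangleInequality

variable {n : Type*} [Fintype n] [DecidableEq n]

/-- For `R`, `G`, `τ` of trace one and `N = G^(-1/2) τ G^(-1/2)`, the quantity `Tr[R log N]` is at
most the relative entropy `Tr[R log (√R G⁻¹ √R)]`, with equality exactly when `τ = R` commutes with
`G`. This is Klein's inequality for `M = G^(-1/2) R G^(-1/2)` and `N`, conjugated by `√G`. -/
theorem trace_mul_mlog_le {R G τ : Matrix n n ℂ} (hR : IsDensity R) (hG : G.PosDef)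
    (hτ : IsDensity τ) (hN : (minvSqrt G * τ * minvSqrt G).PosDef) :
    (R * mlog (minvSqrt G * τ * minvSqrt G)).trace.re ≤
        (R * mlog (msqrt R * minv G * msqrt R)).trace.re ∧
      ((R * mlog (msqrt R * minv G * msqrt R)).trace.re =
        (R * mlog (minvSqrt G * τ * minvSqrt G)).trace.re ↔ τ = R ∧ Commute R G) := by
  have hBS := trace_mul_mlog_eq hG.posSemidef (X := msqrt R) (by rw [hG.mul_minv, Matrix.one_mul])
  rw [(isHermitian_msqrt R).eq, msqrt_mul_msqrt hR.1] at hBS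
  have hST : msqrt G * minvSqrt G = 1 := hG.msqrt_mul_minvSqrt
  have hTS : minvSqrt G * msqrt G = 1 := mul_eq_one_comm.mp hST
  have hSS := msqrt_mul_msqrt hG.posSemidef
  have hSh := (isHermitian_msqrt G).eq
  have hTh := (isHermitian_minvSqrt G).eq
  have hRh := hR.1.isHermitian.eq
  have hτh := hτ.1.isHermitian.eq
  have hcommS : Commute R G → Commute R (msqrt G) := fun h =>
    (cfc_mul_of_intertwine Real.sqrt hG.isHermitian hG.isHermitian h.symm.eq).symm
  set S := msqrt G
  set T := minvSqrt G
  have hM : (T * R * T).PosSemidef := posSemidef_minvSqrt_mul_mul G hR.1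
  have hconj : ∀ Y, S * (T * Y * T) * S = Y := fun Y => by
    rw [← Matrix.mul_assoc, ← Matrix.mul_assoc, hST, Matrix.one_mul, Matrix.mul_assoc, hTS,
      Matrix.mul_one]
  obtain ⟨hle, hiff⟩ := klein_inequality hM hN S
  have e1 : (Sᴴ * cfc (fun x => x * Real.log x) (T * R * T) * S).trace =
      (R * mlog (msqrt R * minv G * msqrt R)).trace := by
    rw [hBS, hSh, Matrix.mul_assoc, trace_mul_comm, Matrix.mul_assoc, hSS, trace_mul_comm]
  have e2 : Sᴴ * (T * R * T) * S = R := by rw [hSh, hconj]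
  have e3 : (Sᴴ * S * (T * τ * T)).trace = 1 := by
    rw [hSh, Matrix.mul_assoc, trace_mul_comm, hconj, hτ.2]
  rw [e1, e2, e3, hR.2, sub_add_cancel] at hle hiff
  refine ⟨sub_nonneg.mp hle, ?_⟩
  rw [← sub_eq_zero, hiff]
  have hleft : T * R * T * S = T * R := by rw [Matrix.mul_assoc, hTS, Matrix.mul_one]
  have hright : S * (T * τ * T) = τ * T := by
    rw [← Matrix.mul_assoc, ← Matrix.mul_assoc, hST, Matrix.one_mul]
  rw [hleft, hright]
  constructor
  · intro h
    have h1 : τ = T * R * S := by rw [h, Matrix.mul_assoc, hTS, Matrix.mul_one]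
    -- `τ = G^(-1/2) R G^(1/2)` is Hermitian, so that `R` commutes with `G`.
    have h2 : T * R * S = S * R * T := by
      rw [← h1, ← hτh, h1, conjTranspose_mul, conjTranspose_mul, hSh, hTh, hRh, Matrix.mul_assoc]
    have hc : Commute R G := by
      have h3 := congrArg (fun Y => S * Y * S) h2
      simp only [Matrix.mul_assoc, hTS, Matrix.mul_one, hSS] at h3
      rw [← Matrix.mul_assoc S T, hST, Matrix.one_mul, ← Matrix.mul_assoc S S, hSS] at h3
      exact h3
    refine ⟨?_, hc⟩
    rw [h1, Matrix.mul_assoc, (hcommS hc).eq, ← Matrix.mul_assoc, hTS, Matrix.one_mul]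
  · rintro ⟨rfl, hc⟩
    have h1 := congrArg (fun Y => T * Y * T) (hcommS hc).eq
    simp only [Matrix.mul_assoc, hST, Matrix.mul_one] at h1
    rw [h1, ← Matrix.mul_assoc T S, hTS, Matrix.one_mul]

end TriangleInequality

/-! ### Subadditivity of the entropy production -/

/-! ### Subadditivity of the entropy production -/

theorem IsDensity.ne_zero {n : Type*} [Fintype n] {ρ : Matrix n n ℂ} (h : IsDensity ρ) :
    ρ ≠ 0 := by
  rintro rfl
  simpa using h.2

theorem IsDensity.nonempty {n : Type*} [Fintype n] {ρ : Matrix n n ℂ} (h : IsDensity ρ) :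
    Nonempty n := by
  by_contra hn
  rw [not_nonempty_iff] at hn
  exact h.ne_zero (Subsingleton.elim _ _)

theorem mainTheorem6 {a b c : Type*} [Fintype a] [DecidableEq a] [Fintype b] [DecidableEq b]
    [Fintype c] [DecidableEq c]
    (E₁ : Matrix a a ℂ →ₗ[ℂ] Matrix b b ℂ) (E₂ : Matrix b b ℂ →ₗ[ℂ] Matrix c c ℂ)
    (hE₁ : IsChannel E₁) (hE₂ : IsChannel E₂) (hr₁ : FullRank E₁) (hr₂ : FullRank E₂)
    (ρ γ : Matrix a a ℂ) (τ₁ : Matrix b b ℂ) (τ₂ : Matrix c c ℂ)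
    (hρ : IsDensity ρ) (hγ : IsDensity γ) (hτ₁ : IsDensity τ₁) (hτ₂ : IsDensity τ₂)
    (h₁ : SupportLE (forwardOp E₁ ρ) (reverseOp E₁ γ τ₁))
    (h₂ : SupportLE (forwardOp E₂ (E₁ ρ)) (reverseOp E₂ (E₁ γ) τ₂)) :
    avgEntropyProduction (E₂ ∘ₗ E₁) ρ γ τ₂ ≤
        avgEntropyProduction E₁ ρ γ τ₁ + avgEntropyProduction E₂ (E₁ ρ) (E₁ γ) τ₂ ∧
      (avgEntropyProduction E₁ ρ γ τ₁ + avgEntropyProduction E₂ (E₁ ρ) (E₁ γ) τ₂ =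
          avgEntropyProduction (E₂ ∘ₗ E₁) ρ γ τ₂ ↔
        τ₁ = E₁ ρ ∧ Commute (E₁ ρ) (E₁ γ)) := by
  have hC₁ := hE₁.posDef_choi hr₁
  have hC₂ := hE₂.posDef_choi hr₂
  have := hτ₁.nonempty
  have := hτ₂.nonempty
  have hC₁₂ := posDef_choi_comp hC₁ hC₂
  have hR := posDef_apply hC₁ hρ.1 hρ.ne_zero
  have hG := posDef_apply hC₁ hγ.1 hγ.ne_zero
  have hRd : IsDensity (E₁ ρ) := ⟨hR.posSemidef, by rw [hE₁.tracePreserving, hρ.2]⟩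
  have hN₁ := posSemidef_minvSqrt_mul_mul (E₁ γ) hτ₁.1
  have hN₂ := posSemidef_minvSqrt_mul_mul (E₂ (E₁ γ)) hτ₂.1
  obtain ⟨hi₁, hs₁⟩ := supports_of_supportLE hC₁ hρ.ne_zero hN₁.isHermitian hγ.1.isHermitian h₁
  obtain ⟨hi₂, hs₂⟩ := supports_of_supportLE hC₂ hRd.ne_zero hN₂.isHermitian hG.isHermitian h₂
  have hp₁ := hN₁.posDef_iff_isUnit.mpr (IsUnit.of_mul_eq_one _ hi₁)
  have hp₂ := hN₂.posDef_iff_isUnit.mpr (IsUnit.of_mul_eq_one _ hi₂)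
  rw [avgEntropyProduction_eq hC₁ hE₁.tracePreserving hρ.1 hγ.1 hp₁ hs₁,
    avgEntropyProduction_eq hC₂ hE₂.tracePreserving hR.posSemidef hG.posSemidef hp₂ hs₂,
    avgEntropyProduction_eq (E := E₂ ∘ₗ E₁) hC₁₂
      (fun M => by rw [LinearMap.comp_apply, hE₂.tracePreserving, hE₁.tracePreserving])
      hρ.1 hγ.1 hp₂ hs₁]
  obtain ⟨hle, hiff⟩ := trace_mul_mlog_le hRd hG hτ₁ hp₁
  rw [LinearMap.comp_apply, LinearMap.comp_apply, ← hiff]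
  exact ⟨by linarith, ⟨fun h => by linarith, fun h => by linarith⟩⟩
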